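/- Let $d=4k+3$ be a prime. Let $\{|e_r\rangle : r\in\mathbb Z_d\}$ be the standard basis of $\mathbb C^d$, with indices taken modulo $d$. Put $\tau=e^{i\pi(d+1)/d}$, let $U|e_r\rangle=e^{2\pi i r/d}|e_r\rangle$ and $V|e_r\rangle=|e_{r+1}\rangle$, and for $0\le r,s\le d-1$ let $W_{(r,s)}=\tau^{rs}V^rU^s$ (the Weyl–Heisenberg matrices). Let $$R_m=\frac1d\sum_{r=0}^{d-1}\sum_{s=0}^{d-1}\tau^{m(r^2+s^2)}W_{(r,s)},\qquad 0\le m\le d-1 .$$ Then the following hold. 1. There is an orthonormal basis $\{|\psi_i\rangle:1\le i\le d\}$ of $\mathbb C^d$ consisting of common eigenvectors of $R_0,\dots,R_{d-1}$, and it is unique up to the order of the vectors and unit phase factors. Its members are eigenvectors of the Fourier matrix $F=\frac1{\sqrt d}\sum_{r,s}e^{2\pi i rs/d}|e_r\rangle\langle e_s|$. 2. The family of the $d^3$ vectors $W_{(k,l)}|\psi_i\rangle$, $1\le i\le d$, $0\le k,l\le d-1$, is a projective $2$-design: these are unit vectors, and for every homogeneous polynomial $f$ of degree $2$ with complex coefficients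 in the entries of a $d\times d$ matrix, the average of $f(|v\rangle\langle v|)$ over the $d^3$ vectors $v$ of the family equals the average of $f(|\varphi\rangle\langle\varphi|)$ over $\mathbb{CP}^{d-1}$ with respect to the unitarily invariant probability measure (equivalently, over unit vectors $\varphi$ with respect to the normalized surface measure of the unit sphere of $\mathbb C^d$). 3. With $P_i^{(k,l)}=W_{(k,l)}|\psi_i\rangle\langle\psi_i|W_{(k,l)}^{-1}$, $$\frac1{d^3}\sum_{i=1}^{d}\sum_{k=0}^{d-1}\sum_{l=0}^{d-1}P_i^{(k,l)}\otimes P_i^{(k,l)}=\frac{2}{d(d+1)}\,\Pi_{\mathrm{sym}},$$ where $\Pi_{\mathrm{sym}}$ is the orthogonal projection of $\mathbb C^d\otimes\mathbb C^d$ onto its symmetric subspace. -/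

import Mathlib

open MeasureTheory
open scoped Kronecker

noncomputable section

namespace FourierDesign

/-- The state space `ℂ^d` with its Hermitian inner product; the standard basis is indexed by
`ℤ/dℤ`. -/
abbrev Ket (d : ℕ) : Type := EuclideanSpace ℂ (ZMod d)

/-- The root of unity `ω = e^{2πi/d}`. -/
def omega (d : ℕ) : ℂ := Complex.exp (2 * Real.pi * Complex.I / d)

/-- The phase `τ = e^{iπ(d+1)/d}`. -/
def tau (d : ℕ) : ℂ := Complex.exp (Complex.I * Real.pi * (d + 1) / d)

/-- The clock matrix, `U e_r = e^{2πir/d} e_r`. -/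
def clock (d : ℕ) : Matrix (ZMod d) (ZMod d) ℂ :=
  Matrix.diagonal fun r => omega d ^ r.val

/-- The shift matrix, `V e_r = e_{r+1}` (indices modulo `d`). -/
def shift (d : ℕ) : Matrix (ZMod d) (ZMod d) ℂ :=
  Matrix.of fun a b => if a = b + 1 then 1 else 0

variable (d : ℕ) [NeZero d]

/-- The Weyl–Heisenberg matrix `W_{(r,s)} = τ^{rs} V^r U^s`, with `0 ≤ r, s ≤ d - 1`. -/
def weyl (r s : ZMod d) : Matrix (ZMod d) (ZMod d) ℂ :=
  tau d ^ (r.val * s.val) • (shift d ^ r.val * clock d ^ s.val)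

/-- `R_m = (1/d) ∑_{r,s} τ^{m(r² + s²)} W_{(r,s)}`, with `0 ≤ m ≤ d - 1`. -/
def rMat (m : ZMod d) : Matrix (ZMod d) (ZMod d) ℂ :=
  (1 / (d : ℂ)) • ∑ r : ZMod d, ∑ s : ZMod d,
    tau d ^ (m.val * (r.val ^ 2 + s.val ^ 2)) • weyl d r s

/-- The Fourier matrix, with entries `e^{2πirs/d} / √d`. -/
def fourierMat : Matrix (ZMod d) (ZMod d) ℂ :=
  Matrix.of fun r s => ((1 / √(d : ℝ) : ℝ) : ℂ) * omega d ^ (r.val * s.val)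

variable {d}

/-- The vector `v` is a (nonzero) eigenvector of the matrix `A`. -/
def IsEigenvector (A : Matrix (ZMod d) (ZMod d) ℂ) (v : Ket d) : Prop :=
  ∃ c : ℂ, Module.End.HasEigenvector (Matrix.toEuclideanLin A) c v

/-- An orthonormal basis of `ℂ^d` all of whose members are eigenvectors of every `R_m`. -/
def IsCommonEigenbasis (ψ : OrthonormalBasis (Fin d) ℂ (Ket d)) : Prop :=
  ∀ (m : ZMod d) (i : Fin d), IsEigenvector (rMat d m) (ψ i)

/-- The matrix `|v⟩⟨v|`. -/
def ketBra {n : Type*} (v : EuclideanSpace ℂ n) : Matrix n n ℂ :=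
  Matrix.of fun a b => v a * star (v b)

/-- A finite family of vectors is a projective 2-design if the vectors have norm one and, for
every homogeneous polynomial `f` of degree 2 in the matrix entries, the mean of `f(|ψ_i⟩⟨ψ_i|)`
over the family is the mean of `f(|φ⟩⟨φ|)` over projective space. The unitarily invariant
probability measure on projective space is the image of the normalized surface measure of the unit
sphere. -/
def IsProjectiveTwoDesign {ι n : Type*} [Fintype ι] [Fintype n]
    (ψ : ι → EuclideanSpace ℂ n) : Prop :=
  (∀ i, ‖ψ i‖ = 1) ∧
  ∀ f : MvPolynomial (n × n) ℂ, f.IsHomogeneous 2 →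
    (1 / (Fintype.card ι : ℂ)) *
        ∑ i, MvPolynomial.eval (fun p : n × n => ketBra (ψ i) p.1 p.2) f =
      ⨍ φ : Metric.sphere (0 : EuclideanSpace ℂ n) 1,
        MvPolynomial.eval (fun p : n × n => ketBra (φ : EuclideanSpace ℂ n) p.1 p.2) f
        ∂((volume : Measure (EuclideanSpace ℂ n)).toSphere)

/-- The symmetric subspace of `ℂ^n ⊗ ℂ^n`, the tensors fixed by the exchange of the two factors;
`ℂ^n ⊗ ℂ^n` is identified with `ℂ^(n × n)`, as in the Kronecker product. -/
def symSubspace (n : Type*) : Submodule ℂ (EuclideanSpace ℂ (n × n)) where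
  carrier := {x | ∀ a b, x (a, b) = x (b, a)}
  add_mem' hx hy a b := by simp [hx a b, hy a b]
  zero_mem' _ _ := rfl
  smul_mem' c x hx a b := by simp [hx a b]

/-- The matrix of the orthogonal projection onto the symmetric subspace. -/
def symProj (n : Type*) [Fintype n] [DecidableEq n] : Matrix (n × n) (n × n) ℂ :=
  (Matrix.toEuclideanCLM (𝕜 := ℂ) (n := n × n)).symm (symSubspace n).starProjection

/-- The displaced projections `P_i^{(k,l)} = W_{(k,l)} |ψ_i⟩⟨ψ_i| W_{(k,l)}⁻¹`. -/
def displacedProj (ψ : OrthonormalBasis (Fin d) ℂ (Ket d)) (i : Fin d) (k l : ZMod d) :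
    Matrix (ZMod d) (ZMod d) ℂ :=
  weyl d k l * ketBra (ψ i) * (weyl d k l)⁻¹

/-- The `d³` vectors `W_{(k,l)} ψ_i`. -/
def displacedKet (ψ : OrthonormalBasis (Fin d) ℂ (Ket d)) (x : Fin d × ZMod d × ZMod d) : Ket d :=
  Matrix.toEuclideanLin (weyl d x.2.1 x.2.2) (ψ x.1)

end FourierDesign

end

open FourierDesign

open FourierDesign

/-! ### Weyl–Heisenberg matrices over `ZMod d`. -/

namespace FourierDesign

open Matrix

variable {d : ℕ} [Fact d.Prime]

/-! Call an operator `∑ c(r² + s²) W_{(r,s)}` radial. Finite Fourier inversion shows that the `R_m`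
span exactly the radial operators. As `d ≡ 3 mod 4`, `-1` is not a square, so `r² + s²` vanishes
only at the origin and every other circle has `d + 1` points. The reflection of the phase plane in
the line of `u ≠ 0` preserves circles and reverses the symplectic phase, so radial operators commute
(`radial_commute`). They form a `*`-closed commuting space of dimension `d`, hence all operators
diagonal in a common eigenbasis. In particular each `|ψ_i⟩⟨ψ_i|` is radial, with some profile `p_i`;
uniqueness of the basis follows, and `F` is a multiple of the `R_m` with `2m = -1`.

For the design, averaging `P ⊗ P` over displacements kills all terms but `W_v ⊗ W_{-v}`, weighted by
`p_i(|v|²)²`. The trace form on radial operators gives `∑ᵢ p_i(n)² = 1/(d N_n)`, with `N_n` the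
number of points on the circle (`exists_ketBra_eq_radial`). Since `N_n` is constant off the origin,
the sum is a combination of `∑ W_v ⊗ W_{-v} = d · swap` and the identity, and the constants make it
a multiple of `1 + swap = 2 Π_sym`. The moments of the sphere are found separately from its
symmetries and have the same form. -/

lemma isPrimitiveRoot_tau (hd : Odd d) : IsPrimitiveRoot (tau d) d := by
  obtain ⟨k, rfl⟩ := hd
  have h0 : 2 * k + 1 ≠ 0 := by omega
  -- For `d = 2k+1`, `τ = exp(2πi(k+1)/d)`, and `2(k+1) - d = 1` gives coprimality.
  have h := Complex.isPrimitiveRoot_exp_of_isCoprime (k + 1) (2 * k + 1) h0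
    ⟨2, -1, by push_cast; ring⟩
  convert h using 1
  unfold tau
  congr 1
  have : ((2 * k + 1 : ℕ) : ℂ) ≠ 0 := by exact_mod_cast h0
  push_cast at this ⊢
  field_simp
  ring

lemma omega_eq_tau_sq : omega d = tau d ^ 2 := by
  have h0 : (d : ℂ) ≠ 0 := by exact_mod_cast (Fact.out : d.Prime).ne_zero
  unfold omega tau
  rw [← Complex.exp_nat_mul]
  rw [Complex.exp_eq_exp_iff_exists_int]
  refine ⟨-1, ?_⟩
  push_cast
  field_simp
  ring

/-- The additive character `x ↦ τ ^ x` of `ℤ/dℤ`. -/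
noncomputable def tauChar (hd : Odd d) : AddChar (ZMod d) ℂ :=
  AddChar.zmodChar d (isPrimitiveRoot_tau hd).pow_eq_one

lemma tauChar_natCast (hd : Odd d) (n : ℕ) : tauChar hd n = tau d ^ n :=
  AddChar.zmodChar_apply' _ n

lemma tauChar_mul_sum (hd : Odd d) (t : ZMod d) :
    ∑ x, tauChar hd (x * t) = if t = 0 then (d : ℂ) else 0 := by
  have hp : (tauChar hd).IsPrimitive :=
    AddChar.zmodChar_primitive_of_primitive_root d (isPrimitiveRoot_tau hd)
  simpa using AddChar.sum_mulShift t hp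

lemma star_tauChar (hd : Odd d) (x : ZMod d) : star (tauChar hd x) = tauChar hd (-x) := by
  have := AddChar.map_neg_eq_conj (tauChar hd) x
  simpa using this.symm

lemma shift_pow_apply (n : ℕ) (a b : ZMod d) :
    (shift d ^ n) a b = if a = b + n then 1 else 0 := by
  induction n generalizing a b with
  | zero => simp [Matrix.one_apply]
  | succ n ih =>
    rw [pow_succ, Matrix.mul_apply]
    simp only [ih]
    simp [shift, add_assoc, add_comm (1 : ZMod d)]

/-- For odd `d` the phase `τ` has order `d`, so exponents may be read in `ZMod d`; from here on the
representatives `val` disappear. -/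
lemma weyl_apply (hd : Odd d) (r s a b : ZMod d) :
    weyl d r s a b = if a = b + r then tauChar hd (r * s + 2 * s * b) else 0 := by
  have e : tauChar hd (r * s + 2 * s * b) = tau d ^ (r.val * s.val) * (omega d ^ b.val) ^ s.val := by
    rw [omega_eq_tau_sq, ← pow_mul, ← pow_mul, ← pow_add, ← tauChar_natCast hd]
    congr 1
    push_cast
    simp only [ZMod.natCast_val, ZMod.cast_id', id]
    ring
  rw [e]
  unfold weyl clock
  rw [Matrix.diagonal_pow, Matrix.smul_apply, Matrix.mul_diagonal, shift_pow_apply]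
  simp

lemma weyl_mul (hd : Odd d) (v w : ZMod d × ZMod d) :
    weyl d v.1 v.2 * weyl d w.1 w.2 =
      tauChar hd (v.2 * w.1 - v.1 * w.2) • weyl d (v.1 + w.1) (v.2 + w.2) := by
  ext a c
  rw [Matrix.mul_apply, Matrix.smul_apply]
  simp only [weyl_apply hd]
  rw [Finset.sum_eq_single (c + w.1)]
  · rw [if_pos rfl]
    by_cases h : a = c + w.1 + v.1
    · rw [if_pos h, if_pos (by rw [h]; ring), smul_eq_mul, ← AddChar.map_add_eq_mul,
        ← AddChar.map_add_eq_mul]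
      congr 1
      ring
    · rw [if_neg h, if_neg (by contrapose! h; rw [h]; ring)]
      simp
  · intro b _ hb
    simp [hb]
  · simp

lemma weyl_zero : weyl d 0 0 = 1 := by
  simp [weyl]

lemma weyl_conjTranspose (hd : Odd d) (v : ZMod d × ZMod d) :
    (weyl d v.1 v.2)ᴴ = weyl d (-v.1) (-v.2) := by
  ext a b
  rw [Matrix.conjTranspose_apply, weyl_apply hd, weyl_apply hd]
  by_cases h : b = a + v.1
  · subst h
    rw [if_pos rfl, if_pos (by ring), star_tauChar]
    congr 1
    ring
  · rw [if_neg h, if_neg (by contrapose! h; rw [h]; ring), star_zero]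

lemma two_ne_zero_of_odd (hd : Odd d) : (2 : ZMod d) ≠ 0 := by
  intro h
  have : (d : ℕ) ∣ 2 := (ZMod.natCast_eq_zero_iff 2 d).1 (by exact_mod_cast h)
  have := (Nat.prime_dvd_prime_iff_eq (Fact.out : d.Prime) Nat.prime_two).1 this
  rw [this] at hd
  exact absurd hd (by decide)

lemma weyl_trace (hd : Odd d) (v : ZMod d × ZMod d) :
    (weyl d v.1 v.2).trace = if v = 0 then (d : ℂ) else 0 := by
  obtain ⟨r, s⟩ := v
  have h2 := two_ne_zero_of_odd hd
  simp only [Matrix.trace, Matrix.diag_apply, weyl_apply hd]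
  by_cases hr : r = 0
  · subst hr
    have := tauChar_mul_sum hd (2 * s)
    simp only [mul_comm _ (2 * s)] at this
    simp [this, h2, Prod.ext_iff]
  · simp [hr, Prod.ext_iff]

lemma weyl_mul_neg (hd : Odd d) (v : ZMod d × ZMod d) :
    weyl d v.1 v.2 * weyl d (-v.1) (-v.2) = 1 := by
  have := weyl_mul hd v (-v)
  simp only [Prod.fst_neg, Prod.snd_neg] at this
  rw [this, add_neg_cancel, add_neg_cancel, weyl_zero]
  rw [show v.2 * -v.1 - v.1 * -v.2 = 0 by ring]
  simp

lemma weyl_inv (hd : Odd d) (v : ZMod d × ZMod d) :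
    (weyl d v.1 v.2)⁻¹ = weyl d (-v.1) (-v.2) :=
  Matrix.inv_eq_right_inv (weyl_mul_neg hd v)

/-- Displacements act on each `W_v` by a character of the phase space; this is what later makes
averaging over them a Fourier orthogonality. -/
lemma weyl_conj (hd : Odd d) (w v : ZMod d × ZMod d) :
    weyl d w.1 w.2 * weyl d v.1 v.2 * (weyl d w.1 w.2)⁻¹ =
      tauChar hd (2 * (w.2 * v.1 - w.1 * v.2)) • weyl d v.1 v.2 := by
  have h1 := weyl_mul hd w v
  have h2 := weyl_mul hd (w + v) (-w)
  simp only [Prod.fst_neg, Prod.snd_neg, Prod.fst_add, Prod.snd_add] at h2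
  rw [weyl_inv hd, h1, Matrix.smul_mul, h2, smul_smul, ← AddChar.map_add_eq_mul]
  congr 2
  · ring
  · ring
  · ring

/-- Traces detect the coefficients of an expansion in the Weyl–Heisenberg matrices. -/
lemma trace_sum_smul_weyl_mul (hd : Odd d) (g h : ZMod d × ZMod d → ℂ) :
    ((∑ v, g v • weyl d v.1 v.2) * ∑ w, h w • weyl d w.1 w.2).trace = d * ∑ v, g v * h (-v) := by
  rw [Finset.sum_mul, Matrix.trace_sum, Finset.mul_sum]
  refine Finset.sum_congr rfl fun v _ => ?_
  rw [Finset.mul_sum, Matrix.trace_sum, Finset.sum_eq_single (-v)]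
  · simp only [Matrix.smul_mul, Matrix.mul_smul, Matrix.trace_smul, Prod.fst_neg, Prod.snd_neg,
      weyl_mul_neg hd, Matrix.trace_one, ZMod.card, smul_eq_mul]
    ring
  · intro w _ hw
    rw [Matrix.smul_mul, Matrix.mul_smul, weyl_mul hd, Matrix.trace_smul, Matrix.trace_smul,
      Matrix.trace_smul, ← Prod.fst_add, ← Prod.snd_add, weyl_trace hd,
      if_neg fun h => hw (eq_neg_of_add_eq_zero_right h)]
    simp
  · simp

/-- The exchange of the two tensor factors. -/
noncomputable def swapMat (n : Type*) [DecidableEq n] : Matrix (n × n) (n × n) ℂ :=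
  Matrix.of fun x y => if x.1 = y.2 ∧ x.2 = y.1 then 1 else 0

/-- The first matrix forces `r = a - b`; the remaining sum over `s` is a character sum that detects
`a = b'`. -/
lemma sum_weyl_kronecker_weyl_neg (hd : Odd d) :
    ∑ v : ZMod d × ZMod d, weyl d v.1 v.2 ⊗ₖ weyl d (-v.1) (-v.2) =
      (d : ℂ) • swapMat (ZMod d) := by
  have h2 := two_ne_zero_of_odd hd
  ext ⟨a, a'⟩ ⟨b, b'⟩
  rw [Matrix.sum_apply, Fintype.sum_prod_type, Finset.sum_eq_single (a - b)]
  · simp only [Matrix.kroneckerMap_apply, weyl_apply hd, Matrix.smul_apply, swapMat, Matrix.of_apply]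
    by_cases h : a' = b' + -(a - b)
    · have hb : a = b + (a - b) := by ring
      simp only [if_pos h, if_pos hb, ← AddChar.map_add_eq_mul]
      have := tauChar_mul_sum hd (2 * (a - b'))
      have e : ∀ x : ZMod d, (a - b) * x + 2 * x * b + (-(a - b) * -x + 2 * -x * b') =
          x * (2 * (a - b')) := fun x => by ring
      simp only [e, this, mul_eq_zero, h2, false_or, sub_eq_zero]
      by_cases h' : a = b'
      · simp [h', h]
      · simp [h']
    · simp only [if_neg h, mul_zero, Finset.sum_const_zero]
      rw [if_neg, smul_zero]
      rintro ⟨rfl, rfl⟩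
      simp at h
  · intro r _ hr
    refine Finset.sum_eq_zero fun s _ => ?_
    rw [Matrix.kroneckerMap_apply, weyl_apply hd, if_neg, zero_mul]
    contrapose! hr
    dsimp only at hr
    rw [hr]
    ring
  · simp

end FourierDesign

/-! ### Circles in the phase plane and the commuting radial operators. -/

namespace FourierDesign

open Matrix

section Circle

variable {K : Type*} [Field K]

/-- The quadratic form `r² + s²` on the phase space `K²`. -/
def normSq (v : K × K) : K := v.1 ^ 2 + v.2 ^ 2

lemma normSq_neg (v : K × K) : normSq (-v) = normSq v := by
  simp [normSq]

/-- The reflection of the plane `K²` in the line spanned by `u`. -/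
def reflect (u v : K × K) : K × K :=
  (((u.1 ^ 2 - u.2 ^ 2) * v.1 + 2 * u.1 * u.2 * v.2) / normSq u,
    (2 * u.1 * u.2 * v.1 - (u.1 ^ 2 - u.2 ^ 2) * v.2) / normSq u)

variable {u : K × K} (hu : normSq u ≠ 0) (v : K × K)
include hu

lemma normSq_reflect : normSq (reflect u v) = normSq v := by
  unfold reflect normSq at *
  field_simp
  ring

/-- The reflection is a linear isometry fixing `u`. -/
lemma normSq_sub_reflect : normSq (u - reflect u v) = normSq (u - v) := by
  unfold reflect normSq at *
  simp only [Prod.fst_sub, Prod.snd_sub]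
  field_simp
  ring

/-- A reflection has determinant `-1`, and `u` is fixed. -/
lemma reflect_symplectic :
    u.2 * (reflect u v).1 - u.1 * (reflect u v).2 = -(u.2 * v.1 - u.1 * v.2) := by
  unfold reflect normSq at *
  field_simp
  ring

lemma reflect_involutive : Function.Involutive (reflect u) := by
  intro v
  unfold reflect normSq at *
  ext
  · field_simp
    ring
  · field_simp
    ring

end Circle

lemma odd_of_mod_four {d : ℕ} (hd : d % 4 = 3) : Odd d := by
  rw [Nat.odd_iff]
  omega

variable {d : ℕ} [Fact d.Prime]

/-- A nonzero isotropic vector would make `-1` the square of `v.1 / v.2`; this is where `d ≡ 3 mod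
4` enters. -/
lemma normSq_eq_zero_iff (hd : d % 4 = 3) (v : ZMod d × ZMod d) : normSq v = 0 ↔ v = 0 := by
  have hn : ¬ IsSquare (-1 : ZMod d) := by
    rw [ZMod.exists_sq_eq_neg_one_iff]
    simpa using hd
  constructor
  · intro h
    by_cases h2 : v.2 = 0
    · simp only [normSq, h2] at h
      ext
      · simpa using h
      · simpa using h2
    · refine absurd ⟨v.1 / v.2, ?_⟩ hn
      unfold normSq at h
      field_simp
      linear_combination -h
  · rintro rfl
    simp [normSq]

/-- The number of points of the circle `r² + s² = n`. -/
def circleCard (d : ℕ) [Fact d.Prime] (n : ZMod d) : ℕ :=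
  (Finset.univ.filter fun v : ZMod d × ZMod d => normSq v = n).card

lemma circleCard_zero (hd : d % 4 = 3) : circleCard d 0 = 1 := by
  rw [circleCard, Finset.card_eq_one]
  exact ⟨0, by ext v; simp [normSq_eq_zero_iff hd]⟩

/-- Write `n = a² + b²`; multiplication by "`a + bi`" scales the form by `n` and carries the unit
circle onto the circle of `n`. -/
lemma circleCard_eq_one_circle {n : ZMod d} (hn : n ≠ 0) : circleCard d n = circleCard d 1 := by
  obtain ⟨a, b, hab⟩ := ZMod.sq_add_sq d n
  symm
  unfold circleCard
  refine Finset.card_nbij' (fun v => (a * v.1 - b * v.2, b * v.1 + a * v.2))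
    (fun v => ((a * v.1 + b * v.2) / n, (-b * v.1 + a * v.2) / n)) ?_ ?_ ?_ ?_
  · intro v hv
    rw [Finset.mem_coe, Finset.mem_filter] at hv ⊢
    refine ⟨Finset.mem_univ _, ?_⟩
    replace hv := hv.2
    unfold normSq at hv ⊢
    linear_combination n * hv + (v.1 ^ 2 + v.2 ^ 2) * hab
  · intro v hv
    rw [Finset.mem_coe, Finset.mem_filter] at hv ⊢
    refine ⟨Finset.mem_univ _, ?_⟩
    replace hv := hv.2
    unfold normSq at hv ⊢
    field_simp
    linear_combination n * hv + (v.1 ^ 2 + v.2 ^ 2) * hab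
  · intro v _
    ext
    · field_simp
      linear_combination v.1 * hab
    · field_simp
      linear_combination v.2 * hab
  · intro v _
    ext
    · field_simp
      linear_combination v.1 * hab
    · field_simp
      linear_combination v.2 * hab

lemma circleCard_of_ne_zero (hd : d % 4 = 3) {n : ZMod d} (hn : n ≠ 0) :
    circleCard d n = d + 1 := by
  rw [circleCard_eq_one_circle hn]
  have h := Finset.card_eq_sum_card_fiberwise (f := (normSq : ZMod d × ZMod d → ZMod d))
    (s := Finset.univ) (t := Finset.univ) (fun _ _ => Finset.mem_coe.2 (Finset.mem_univ _))
  change _ = ∑ m, circleCard d m at h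
  rw [← Finset.add_sum_erase _ _ (Finset.mem_univ 0), circleCard_zero hd,
    Finset.sum_congr rfl fun m hm => circleCard_eq_one_circle (Finset.ne_of_mem_erase hm)] at h
  simp only [Finset.card_univ, Fintype.card_prod, ZMod.card, Finset.sum_const, smul_eq_mul,
    Finset.card_erase_of_mem (Finset.mem_univ (0 : ZMod d))] at h
  -- Counting the plane by circles gives `d² = 1 + (d - 1) N`; the substitution avoids truncated
  -- subtraction when cancelling `d - 1`.
  obtain ⟨e, he⟩ : ∃ e, d = e + 2 := ⟨d - 2, by have := (Fact.out : d.Prime).two_le; omega⟩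
  have e1 : d - 1 = e + 1 := by omega
  rw [e1] at h
  have : (e + 1) * circleCard d 1 = (e + 1) * (d + 1) := by
    have h' : (e + 2) * (e + 2) = 1 + (e + 1) * circleCard d 1 := by rw [← he]; exact h
    have h'' : (e + 1) * (d + 1) = (e + 1) * (e + 2 + 1) := by rw [he]
    nlinarith
  exact Nat.eq_of_mul_eq_mul_left (Nat.succ_pos e) this

lemma sum_comp_normSq {M : Type*} [AddCommMonoid M] (f : ZMod d → M) :
    ∑ v : ZMod d × ZMod d, f (normSq v) = ∑ n, circleCard d n • f n := by
  rw [← Finset.sum_fiberwise Finset.univ (normSq : ZMod d × ZMod d → ZMod d)]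
  refine Finset.sum_congr rfl fun n _ => ?_
  rw [Finset.sum_congr rfl fun v hv => by rw [(Finset.mem_filter.1 hv).2]]
  simp [circleCard]

/-- The radial operator `∑ c(r² + s²) W_{(r,s)}`. -/
noncomputable def radial (d : ℕ) [Fact d.Prime] :
    (ZMod d → ℂ) →ₗ[ℂ] Matrix (ZMod d) (ZMod d) ℂ where
  toFun c := ∑ v : ZMod d × ZMod d, c (normSq v) • weyl d v.1 v.2
  map_add' c c' := by simp [add_smul, Finset.sum_add_distrib]
  map_smul' z c := by simp [Finset.smul_sum, smul_smul]

lemma radial_apply (c : ZMod d → ℂ) :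
    radial d c = ∑ v : ZMod d × ZMod d, c (normSq v) • weyl d v.1 v.2 := rfl

/-- The trace pairs `W_v` with `W_{-v}`, which lies on the same circle, so the circle sums are
orthogonal with weights `d N_n`. -/
lemma trace_radial_mul (hd : Odd d) (c c' : ZMod d → ℂ) :
    (radial d c * radial d c').trace = d * ∑ n, (circleCard d n : ℂ) * (c n * c' n) := by
  rw [radial_apply, radial_apply,
    trace_sum_smul_weyl_mul hd (fun v => c (normSq v)) (fun v => c' (normSq v))]
  simp only [normSq_neg, ← nsmul_eq_mul, sum_comp_normSq fun n => c n * c' n]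

lemma circleCard_ne_zero (hd : d % 4 = 3) (n : ZMod d) : (circleCard d n : ℂ) ≠ 0 := by
  rcases eq_or_ne n 0 with rfl | hn
  · simp [circleCard_zero hd]
  · rw [circleCard_of_ne_zero hd hn]
    exact_mod_cast Nat.succ_ne_zero d

lemma radial_injective (hd : d % 4 = 3) : Function.Injective (radial d) := by
  rw [injective_iff_map_eq_zero]
  intro c hc
  ext n
  have h := trace_radial_mul (odd_of_mod_four hd) c (Pi.single n 1)
  rw [hc, Matrix.zero_mul, Matrix.trace_zero, Finset.sum_eq_single n] at h
  · have h0 : (d : ℂ) ≠ 0 := by exact_mod_cast (Fact.out : d.Prime).ne_zero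
    simpa [h0, circleCard_ne_zero hd n] using h
  · intro m _ hm
    simp [hm]
  · simp

lemma radial_conjTranspose (hd : Odd d) (c : ZMod d → ℂ) :
    (radial d c)ᴴ = radial d (star c) := by
  simp only [radial_apply, Matrix.conjTranspose_sum, Matrix.conjTranspose_smul,
    weyl_conjTranspose hd]
  rw [← Equiv.sum_comp (Equiv.neg _)]
  simp [normSq_neg]

lemma radial_mul (hd : Odd d) (c c' : ZMod d → ℂ) :
    radial d c * radial d c' = ∑ u : ZMod d × ZMod d,
      (∑ v : ZMod d × ZMod d, c (normSq v) * c' (normSq (u - v)) *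
        tauChar hd (-(u.1 * -v.2 - u.2 * -v.1))) • weyl d u.1 u.2 := by
  rw [radial_apply, radial_apply, Finset.sum_mul]
  simp only [Finset.mul_sum, Finset.sum_smul]
  conv_rhs => rw [Finset.sum_comm]
  refine Finset.sum_congr rfl fun v _ => ?_
  rw [← Equiv.sum_comp (Equiv.subRight v)]
  refine Finset.sum_congr rfl fun u _ => ?_
  rw [Matrix.smul_mul, Matrix.mul_smul, weyl_mul hd]
  simp only [Equiv.subRight_apply, Prod.fst_sub, Prod.snd_sub, smul_smul]
  congr 1
  · rw [← mul_assoc]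
    congr 2
    ring
  · congr 1
    · ring
    · ring

/-- Exchanging the factors amounts to `v ↦ u - v`, which reverses the sign of the phase in the
coefficient of `W_u`. Reflection in the line of `u` reverses it back while preserving the norms of
`v` and `u - v`. -/
lemma radial_commute (hd : d % 4 = 3) (c c' : ZMod d → ℂ) :
    Commute (radial d c) (radial d c') := by
  have ho := odd_of_mod_four hd
  rw [Commute, SemiconjBy, radial_mul ho, radial_mul ho]
  refine Finset.sum_congr rfl fun u _ => ?_
  congr 1
  conv_rhs => rw [← Equiv.sum_comp (Equiv.subLeft u)]
  simp only [Equiv.subLeft_apply, sub_sub_cancel]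
  by_cases hu : u = 0
  · subst hu
    refine Finset.sum_congr rfl fun v _ => ?_
    simp [mul_comm]
  · have hq : normSq u ≠ 0 := by rwa [Ne, normSq_eq_zero_iff hd]
    rw [← Equiv.sum_comp (reflect_involutive hq).toPerm]
    refine Finset.sum_congr rfl fun v _ => ?_
    simp only [Function.Involutive.coe_toPerm, normSq_reflect hq, normSq_sub_reflect hq]
    rw [mul_comm (c _)]
    congr 2
    have := reflect_symplectic hq v
    simp only [Prod.fst_sub, Prod.snd_sub]
    linear_combination -this

lemma rMat_eq_radial (hd : Odd d) (m : ZMod d) :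
    rMat d m = radial d fun n => tauChar hd (m * n) / d := by
  unfold rMat
  rw [radial_apply, Fintype.sum_prod_type, Finset.smul_sum]
  refine Finset.sum_congr rfl fun r _ => ?_
  rw [Finset.smul_sum]
  refine Finset.sum_congr rfl fun s _ => ?_
  rw [smul_smul, ← tauChar_natCast hd]
  congr 1
  push_cast
  simp only [ZMod.natCast_val, ZMod.cast_id', id, normSq]
  ring

/-- Fourier inversion: the matrices `R_m` span the radial operators. -/
lemma radial_eq_sum_rMat (hd : Odd d) (c : ZMod d → ℂ) :
    radial d c = ∑ m, (∑ n, c n * tauChar hd (-(m * n))) • rMat d m := by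
  simp only [rMat_eq_radial hd, ← map_smul, ← map_sum]
  congr 1
  ext k
  have h0 : (d : ℂ) ≠ 0 := by exact_mod_cast (Fact.out : d.Prime).ne_zero
  simp only [Finset.sum_apply, Pi.smul_apply, smul_eq_mul, Finset.sum_mul]
  rw [Finset.sum_comm]
  have e : ∀ n m : ZMod d, c n * tauChar hd (-(m * n)) * (tauChar hd (m * k) / d) =
      c n / d * tauChar hd (m * (k - n)) := by
    intro n m
    rw [show m * (k - n) = -(m * n) + m * k by ring, AddChar.map_add_eq_mul]
    ring
  simp only [e, ← Finset.mul_sum, tauChar_mul_sum, sub_eq_zero]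
  simp [h0]

end FourierDesign

/-! ### Second moments of the sphere and projective designs. -/

namespace FourierDesign

section Sphere

open scoped Pointwise

variable {E : Type*} [NormedAddCommGroup E] [InnerProductSpace ℝ E] [FiniteDimensional ℝ E]
  [MeasurableSpace E] [BorelSpace E]

/-- The action of a linear isometry on the unit sphere. -/
def sphereMap (e : E ≃ₗᵢ[ℝ] E) :
    C(Metric.sphere (0 : E) 1, Metric.sphere (0 : E) 1) where
  toFun x := ⟨e x, by simp⟩

/-- The surface measure of a set is a multiple of the volume of the cone over it, and a linear
isometry preserves cones and volume. -/
lemma measurePreserving_sphereMap (e : E ≃ₗᵢ[ℝ] E) :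
    MeasurePreserving (sphereMap e) (volume : Measure E).toSphere (volume : Measure E).toSphere := by
  have hm : Measurable (sphereMap e) := (sphereMap e).continuous.measurable
  refine ⟨hm, ?_⟩
  ext s hs
  rw [Measure.map_apply hm hs, Measure.toSphere_apply' _ (hm hs), Measure.toSphere_apply' _ hs]
  congr 1
  have : Set.Ioo (0 : ℝ) 1 • ((↑) '' (sphereMap e ⁻¹' s) : Set E) =
      e ⁻¹' (Set.Ioo (0 : ℝ) 1 • ((↑) '' s : Set E)) := by
    ext x
    simp only [Set.mem_smul, Set.mem_image, Set.mem_preimage, Subtype.exists, exists_and_right,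
      exists_eq_right]
    constructor
    · rintro ⟨r, hr, y, ⟨hy, hys⟩, rfl⟩
      exact ⟨r, hr, e y, ⟨by simpa using hy, hys⟩, by simp⟩
    · rintro ⟨r, hr, y, ⟨hy, hys⟩, h⟩
      refine ⟨r, hr, e.symm y, ⟨by simpa using hy, ?_⟩, ?_⟩
      · convert! hys
        simp [sphereMap]
      · apply e.injective
        simpa using h
  rw [this]
  exact e.measurePreserving.measure_preimage_equiv (f := e.toMeasurableEquiv) _

end Sphere

variable {n : Type*} [Fintype n]

/-- The unit sphere of `ℂ^n`. -/
abbrev KetSphere (n : Type*) [Fintype n] : Type _ := Metric.sphere (0 : EuclideanSpace ℂ n) 1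

/-- The mean over the unit sphere. -/
noncomputable def sphereMean (n : Type*) [Fintype n] : C(KetSphere n, ℂ) →ₗ[ℂ] ℂ where
  toFun f := ⨍ φ, f φ ∂((volume : Measure (EuclideanSpace ℂ n)).toSphere)
  map_add' f g := by
    simp only [average_eq, ContinuousMap.add_apply]
    rw [integral_add, smul_add]
    · exact f.continuous.integrable_of_hasCompactSupport (HasCompactSupport.of_compactSpace _)
    · exact g.continuous.integrable_of_hasCompactSupport (HasCompactSupport.of_compactSpace _)
  map_smul' c f := by
    simp only [average_eq, ContinuousMap.smul_apply, RingHom.id_apply]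
    rw [integral_smul, smul_comm]

lemma sphereMean_comp (e : EuclideanSpace ℂ n ≃ₗᵢ[ℝ] EuclideanSpace ℂ n) (f : C(KetSphere n, ℂ)) :
    sphereMean n (f.comp (sphereMap e)) = sphereMean n f := by
  simp only [sphereMean, LinearMap.coe_mk, AddHom.coe_mk, average_eq]
  congr 1
  have h := measurePreserving_sphereMap e
  conv_rhs => rw [← h.map_eq]
  rw [integral_map h.measurable.aemeasurable f.continuous.aestronglyMeasurable]
  rfl

lemma sphereMean_one [Nonempty n] : sphereMean n 1 = 1 := by
  simp only [sphereMean, LinearMap.coe_mk, AddHom.coe_mk]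
  have : NeZero (volume : Measure (EuclideanSpace ℂ n)).toSphere := ⟨Measure.toSphere_ne_zero _⟩
  exact average_const ((volume : Measure (EuclideanSpace ℂ n)).toSphere) (1 : ℂ)

/-- The coordinate functions on the unit sphere. -/
noncomputable def coord (a : n) : C(KetSphere n, ℂ) where
  toFun φ := (φ : EuclideanSpace ℂ n) a

@[simp] lemma coord_apply (a : n) (φ : KetSphere n) :
    coord a φ = (φ : EuclideanSpace ℂ n) a := rfl

/-- The entries of `|φ⟩⟨φ|` as functions on the unit sphere. -/
noncomputable def ketBraEntry (a b : n) : C(KetSphere n, ℂ) := coord a * star (coord b)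

lemma ketBraEntry_apply (a b : n) (φ : KetSphere n) :
    ketBraEntry a b φ = (φ : EuclideanSpace ℂ n) a * star ((φ : EuclideanSpace ℂ n) b) := rfl

lemma sum_ketBraEntry : ∑ a : n, ketBraEntry a a = 1 := by
  ext φ
  have h : ‖(φ : EuclideanSpace ℂ n)‖ ^ 2 = 1 := by
    rw [norm_eq_of_mem_sphere φ, one_pow]
  rw [EuclideanSpace.norm_sq_eq] at h
  rw [ContinuousMap.sum_apply, ContinuousMap.one_apply]
  simp only [ketBraEntry_apply]
  have h' := congrArg ((↑) : ℝ → ℂ) h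
  rw [Complex.ofReal_sum, Complex.ofReal_one] at h'
  rw [← h']
  refine Finset.sum_congr rfl fun a _ => ?_
  rw [Complex.star_def, Complex.mul_conj, Complex.normSq_eq_norm_sq]

variable [DecidableEq n]

/-- Multiplication of one coordinate by `i`. -/
noncomputable def phaseShift (c : n) : EuclideanSpace ℂ n ≃ₗᵢ[ℝ] EuclideanSpace ℂ n :=
  LinearIsometryEquiv.piLpCongrRight 2 fun a =>
    if a = c then rotation ⟨Complex.I, by simp [Submonoid.unitSphere]⟩ else LinearIsometryEquiv.refl ℝ ℂ

lemma phaseShift_apply (c a : n) (φ : EuclideanSpace ℂ n) :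
    phaseShift c φ a = (if a = c then Complex.I else 1) * φ a := by
  by_cases h : a = c
  · simp only [phaseShift, LinearIsometryEquiv.piLpCongrRight_apply, h, if_true]
    exact rotation_apply _ _
  · simp [phaseShift, h]

lemma sphereMean_eq_phase_mul (c a b a' b' : n) :
    sphereMean n (ketBraEntry a b * ketBraEntry a' b') =
      ((if a = c then Complex.I else 1) * star (if b = c then Complex.I else 1) *
        ((if a' = c then Complex.I else 1) * star (if b' = c then Complex.I else 1))) *
      sphereMean n (ketBraEntry a b * ketBraEntry a' b') := by
  conv_lhs => rw [← sphereMean_comp (phaseShift c)]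
  rw [← smul_eq_mul (_ * _) (sphereMean n _), ← map_smul]
  congr 1
  ext φ
  simp only [ContinuousMap.comp_apply, ContinuousMap.mul_apply, ketBraEntry_apply, sphereMap,
    ContinuousMap.coe_mk, phaseShift_apply, ContinuousMap.smul_apply, smul_eq_mul, star_mul']
  ring

/-- If the indices do not cancel, some coordinate has unequal numbers of conjugated and unconjugated
factors. Multiplying it by `i` scales the moment by a number other than `1`. -/
lemma sphereMean_eq_zero {a b a' b' : n} (h : ¬ (a = b ∧ a' = b')) (h' : ¬ (a = b' ∧ a' = b)) :
    sphereMean n (ketBraEntry a b * ketBraEntry a' b') = 0 := by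
  have key : ∀ z : ℂ, z ≠ 1 →
      sphereMean n (ketBraEntry a b * ketBraEntry a' b') =
        z * sphereMean n (ketBraEntry a b * ketBraEntry a' b') →
      sphereMean n (ketBraEntry a b * ketBraEntry a' b') = 0 := by
    intro z hz e
    have : (1 - z) * sphereMean n (ketBraEntry a b * ketBraEntry a' b') = 0 := by
      linear_combination e
    exact (mul_eq_zero.1 this).resolve_left (sub_ne_zero.2 hz.symm)
  have hI : Complex.I ≠ 1 := fun e => by simpa using congrArg Complex.re e
  have hn : (-1 : ℂ) ≠ 1 := by norm_num
  by_cases h1 : a = b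
  · subst h1
    have h2 : a' ≠ b' := fun e => h ⟨rfl, e⟩
    refine key _ ?_ (sphereMean_eq_phase_mul a' _ _ _ _)
    by_cases h3 : a = a'
    · simp [h3, h2.symm, hI]
    · simp [h3, h2.symm, hI]
  · by_cases h2 : a = b'
    · subst h2
      have h3 : a' ≠ b := fun e => h' ⟨rfl, e⟩
      refine key _ ?_ (sphereMean_eq_phase_mul a' _ _ _ _)
      by_cases h4 : a = a'
      · simp [h4, h3.symm, hI]
      · simp [h4, h3.symm, hI]
    · refine key _ ?_ (sphereMean_eq_phase_mul a _ _ _ _)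
      by_cases h3 : a' = a
      · simp [h3, Ne.symm h1, Ne.symm h2, hn]
      · simp [h3, Ne.symm h1, Ne.symm h2, hI]

/-- The reflection of `ℂ^n` that fixes `e_a + 2 e_b`. -/
noncomputable def planeReflection (a b : n) : EuclideanSpace ℂ n ≃ₗᵢ[ℝ] EuclideanSpace ℂ n :=
  let e := (ℂ ∙ (EuclideanSpace.single a (1 : ℂ) + EuclideanSpace.single b 2)).reflection
  { e.toLinearEquiv.restrictScalars ℝ with norm_map' := e.norm_map }

/-- The vector `e_a + 2e_b` has squared norm `5`, so the reflection is rational and, unlike a swap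
of coordinates, mixes them. -/
lemma planeReflection_apply {a b : n} (hab : a ≠ b) (φ : EuclideanSpace ℂ n) :
    planeReflection a b φ a = (-3 * φ a + 4 * φ b) / 5 ∧
      planeReflection a b φ b = (4 * φ a + 3 * φ b) / 5 := by
  set w : EuclideanSpace ℂ n := EuclideanSpace.single a (1 : ℂ) + EuclideanSpace.single b 2 with hw
  have hi : ∀ x : EuclideanSpace ℂ n, inner ℂ w x = x a + 2 * x b := by
    intro x
    simp [hw, EuclideanSpace.inner_single_left, Complex.conj_ofNat]
  have hwa : w a = 1 := by simp [hw, hab]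
  have hwb : w b = 2 := by simp [hw, hab.symm]
  have hn : ((‖w‖ : ℝ) : ℂ) ^ 2 = 5 := by
    have := inner_self_eq_norm_sq_to_K (𝕜 := ℂ) w
    rw [hi, hwa, hwb] at this
    refine this.symm.trans (by norm_num)
  have h : planeReflection a b φ = (ℂ ∙ w).reflection φ := rfl
  rw [h, Submodule.reflection_singleton_apply]
  simp only [PiLp.sub_apply, PiLp.smul_apply, hi, hwa, hwb, smul_eq_mul, nsmul_eq_mul]
  erw [hn]
  constructor
  · push_cast
    ring
  · push_cast
    ring

/-- Invariance of the moments of `|φ_a|⁴` and `|φ_b|⁴` under the mixing reflection gives two linear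
equations in the three moments that survive the phase symmetry. -/
lemma sphereMean_reflection {a b : n} (hab : a ≠ b) :
    sphereMean n (ketBraEntry a a * ketBraEntry a a) =
        2 * sphereMean n (ketBraEntry a a * ketBraEntry b b) ∧
      sphereMean n (ketBraEntry a a * ketBraEntry a a) =
        sphereMean n (ketBraEntry b b * ketBraEntry b b) := by
  set X := ketBraEntry a a with hX
  set Y := ketBraEntry b b with hY
  set P := ketBraEntry a b with hP
  set Q := ketBraEntry b a with hQ
  have ea : X.comp (sphereMap (planeReflection a b)) =
      (25 : ℂ)⁻¹ • ((9 : ℂ) • X + (16 : ℂ) • Y - (12 : ℂ) • (P + Q)) := by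
    ext φ
    simp only [hX, hY, hP, hQ, ContinuousMap.comp_apply, ketBraEntry_apply, sphereMap,
      ContinuousMap.coe_mk, (planeReflection_apply hab _).1, ContinuousMap.smul_apply,
      ContinuousMap.add_apply, ContinuousMap.sub_apply, smul_eq_mul, Complex.star_def, map_add,
      map_div₀, map_mul, map_neg, map_ofNat]
    ring
  have eb : Y.comp (sphereMap (planeReflection a b)) =
      (25 : ℂ)⁻¹ • ((16 : ℂ) • X + (9 : ℂ) • Y + (12 : ℂ) • (P + Q)) := by
    ext φ
    simp only [hX, hY, hP, hQ, ContinuousMap.comp_apply, ketBraEntry_apply, sphereMap,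
      ContinuousMap.coe_mk, (planeReflection_apply hab _).2, ContinuousMap.smul_apply,
      ContinuousMap.add_apply, smul_eq_mul, Complex.star_def, map_add,
      map_div₀, map_mul, map_ofNat]
    ring
  have hPQ : P * Q = X * Y := by
    simp only [hX, hY, hP, hQ, ketBraEntry]
    ring
  have hQP : Q * P = X * Y := by rw [mul_comm, hPQ]
  have hYX : Y * X = X * Y := mul_comm _ _
  have z1 : sphereMean n (P * P) = 0 := sphereMean_eq_zero (by simp [hab]) (by simp [hab])
  have z2 : sphereMean n (Q * Q) = 0 := sphereMean_eq_zero (by simp [hab.symm]) (by simp [hab.symm])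
  have z3 : sphereMean n (X * P) = 0 := sphereMean_eq_zero (by simp [hab]) (by simp [hab])
  have z4 : sphereMean n (X * Q) = 0 := sphereMean_eq_zero (by simp [hab.symm]) (by simp [hab.symm])
  have z5 : sphereMean n (Y * P) = 0 := sphereMean_eq_zero (by simp [hab]) (by simp [hab])
  have z6 : sphereMean n (Y * Q) = 0 := sphereMean_eq_zero (by simp [hab.symm]) (by simp [hab.symm])
  have z3' : sphereMean n (P * X) = 0 := by rw [mul_comm, z3]
  have z4' : sphereMean n (Q * X) = 0 := by rw [mul_comm, z4]
  have z5' : sphereMean n (P * Y) = 0 := by rw [mul_comm, z5]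
  have z6' : sphereMean n (Q * Y) = 0 := by rw [mul_comm, z6]
  have hmul : ∀ f g : C(KetSphere n, ℂ), (f * g).comp (sphereMap (planeReflection a b)) =
      f.comp (sphereMap (planeReflection a b)) * g.comp (sphereMap (planeReflection a b)) :=
    fun f g => rfl
  have e1 := sphereMean_comp (planeReflection a b) (X * X)
  have e2 := sphereMean_comp (planeReflection a b) (Y * Y)
  rw [hmul, ea] at e1
  rw [hmul, eb] at e2
  simp only [smul_mul_smul_comm, add_mul, mul_add, sub_mul, mul_sub, smul_add, smul_sub, map_add,
    map_sub, map_smul, hPQ, hQP, hYX, z1, z2, z3, z4, z5, z6, z3', z4', z5', z6',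
    smul_eq_mul] at e1 e2
  have e3 : sphereMean n (X * X) = sphereMean n (Y * Y) := by
    linear_combination (-25 / 32 : ℂ) * (e1 - e2)
  refine ⟨?_, e3⟩
  linear_combination (-625 / 288 : ℂ) * e1 - (256 / 288 : ℂ) * e3

lemma sphereMean_ketBraEntry_mul [Nonempty n] (a b a' b' : n) :
    sphereMean n (ketBraEntry a b * ketBraEntry a' b') =
      ((if a = b ∧ a' = b' then 1 else 0) + (if a = b' ∧ a' = b then 1 else 0)) /
        ((Fintype.card n : ℂ) * (Fintype.card n + 1)) := by
  have hN : (Fintype.card n : ℂ) ≠ 0 := by exact_mod_cast Fintype.card_ne_zero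
  have hN1 : (Fintype.card n : ℂ) + 1 ≠ 0 := by exact_mod_cast Nat.succ_ne_zero (Fintype.card n)
  obtain ⟨c⟩ := ‹Nonempty n›
  set A := sphereMean n (ketBraEntry c c * ketBraEntry c c) with hA
  have h1 : ∀ a b : n, sphereMean n (ketBraEntry a a * ketBraEntry b b) =
      A / 2 * (1 + if a = b then 1 else 0) := by
    have h0 : ∀ a : n, sphereMean n (ketBraEntry a a * ketBraEntry a a) = A := by
      intro a
      by_cases h : a = c
      · rw [h]
      · exact (sphereMean_reflection h).2
    intro a b
    by_cases h : a = b
    · subst h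
      rw [h0]
      simp
      ring
    · have := (sphereMean_reflection h).1
      rw [h0] at this
      rw [this]
      simp [h]
  -- The square of `∑ |φ_a|² = 1` fixes the one remaining constant.
  have hsum : ∑ a : n, ∑ b : n, sphereMean n (ketBraEntry a a * ketBraEntry b b) = 1 := by
    have : Nonempty n := ⟨c⟩
    simp only [← map_sum]
    rw [← Finset.sum_mul_sum, sum_ketBraEntry, mul_one, sphereMean_one]
  have hval : A = 2 / ((Fintype.card n : ℂ) * (Fintype.card n + 1)) := by
    simp only [h1, ← Finset.mul_sum, Finset.sum_add_distrib, Finset.sum_ite_eq, Finset.mem_univ,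
      if_true, Finset.sum_const, Finset.card_univ, nsmul_eq_mul, mul_one] at hsum
    field_simp
    linear_combination 2 * hsum
  by_cases h : a = b ∧ a' = b'
  · obtain ⟨rfl, rfl⟩ := h
    rw [h1, hval]
    by_cases h2 : a = a'
    · subst h2
      simp
      ring
    · simp [h2]
      field_simp
  · by_cases h' : a = b' ∧ a' = b
    · obtain ⟨rfl, rfl⟩ := h'
      have : ketBraEntry a a' * ketBraEntry a' a = ketBraEntry a a * ketBraEntry a' a' := by
        unfold ketBraEntry
        ring
      have h2 : a ≠ a' := fun e => h ⟨e, e.symm⟩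
      rw [this, h1, hval]
      simp [h2]
      field_simp
    · rw [sphereMean_eq_zero h h', if_neg h, if_neg h']
      simp

lemma symProj_eq : symProj n = (1 / 2 : ℂ) • (1 + swapMat n) := by
  unfold symProj
  rw [StarAlgEquiv.symm_apply_eq]
  ext1 x
  have hs : ∀ y : EuclideanSpace ℂ (n × n), ∀ a b,
      Matrix.toEuclideanCLM (𝕜 := ℂ) (n := n × n) ((1 / 2 : ℂ) • (1 + swapMat n)) y (a, b) =
        (y (a, b) + y (b, a)) / 2 := by
    intro y a b
    rw [Matrix.ofLp_toEuclideanCLM, Matrix.smul_mulVec, Matrix.add_mulVec, Matrix.one_mulVec]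
    have : (swapMat n).mulVec y.ofLp (a, b) = y (b, a) := by
      rw [Matrix.mulVec, dotProduct, Finset.sum_eq_single (b, a)]
      · simp [swapMat]
      · rintro ⟨c, e⟩ _ h
        rw [swapMat, Matrix.of_apply, if_neg, zero_mul]
        rintro ⟨h1, h2⟩
        dsimp only at h1 h2
        exact h (by rw [h1, h2])
      · simp
    rw [Pi.smul_apply, Pi.add_apply, this, smul_eq_mul]
    ring
  refine Submodule.eq_starProjection_of_mem_of_inner_eq_zero (K := symSubspace n) ?_ ?_
  · intro a b
    rw [hs, hs, add_comm]
  · intro w hw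
    rw [PiLp.inner_apply]
    -- The residue of the symmetrization is antisymmetric, so its pairing with a symmetric tensor
    -- cancels under exchange.
    have key : ∀ f : n × n → ℂ, (∀ a b, f (a, b) = -f (b, a)) → ∑ p, f p = 0 := by
      intro f hf
      have : ∑ p, f p = -∑ p, f p := by
        conv_lhs => rw [← Equiv.sum_comp (Equiv.prodComm n n)]
        rw [← Finset.sum_neg_distrib]
        exact Finset.sum_congr rfl fun p _ => hf _ _
      linear_combination (1 / 2 : ℂ) * this
    refine key _ fun a b => ?_
    rw [hw a b]
    simp only [PiLp.sub_apply, hs, RCLike.inner_apply, map_sub, map_div₀, map_add]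
    simp only [Complex.conj_ofNat]
    ring

/-- A family of unit vectors whose second tensor moment is proportional to the projection onto the
symmetric subspace is a projective 2-design. -/
theorem isProjectiveTwoDesign_of_sum_kronecker [Nonempty n] {ι : Type*} [Fintype ι]
    (ψ : ι → EuclideanSpace ℂ n) (h1 : ∀ i, ‖ψ i‖ = 1)
    (h2 : (1 / (Fintype.card ι : ℂ)) • ∑ i, ketBra (ψ i) ⊗ₖ ketBra (ψ i) =
      (2 / ((Fintype.card n : ℂ) * (Fintype.card n + 1))) • symProj n) :
    IsProjectiveTwoDesign ψ := by
  refine ⟨h1, fun f hf => ?_⟩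
  have hR : (⨍ φ : Metric.sphere (0 : EuclideanSpace ℂ n) 1,
        MvPolynomial.eval (fun p : n × n => ketBra (φ : EuclideanSpace ℂ n) p.1 p.2) f
        ∂((volume : Measure (EuclideanSpace ℂ n)).toSphere)) =
      sphereMean n (MvPolynomial.aeval (fun p : n × n => ketBraEntry p.1 p.2) f) := by
    simp only [sphereMean, LinearMap.coe_mk, AddHom.coe_mk]
    congr 1
    ext φ
    clear hf
    induction f using MvPolynomial.induction_on with
    | C c => simp [Algebra.algebraMap_eq_smul_one]
    | add p q hp hq => simp only [map_add, hp, hq, ContinuousMap.add_apply]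
    | mul_X p q hp =>
      simp only [map_mul, hp, ContinuousMap.mul_apply, MvPolynomial.eval_X, MvPolynomial.aeval_X]
      rfl
  rw [hR]
  have hent : ∀ a b a' b' : n, (1 / (Fintype.card ι : ℂ)) *
      ∑ i, ketBra (ψ i) a b * ketBra (ψ i) a' b' =
        sphereMean n (ketBraEntry a b * ketBraEntry a' b') := by
    intro a b a' b'
    have h := congrFun (congrFun h2 (a, a')) (b, b')
    rw [symProj_eq, Matrix.smul_apply, Matrix.sum_apply] at h
    simp only [Matrix.kroneckerMap_apply, smul_eq_mul] at h
    rw [h, sphereMean_ketBraEntry_mul]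
    simp only [Matrix.smul_apply, Matrix.add_apply, Matrix.one_apply, swapMat, Matrix.of_apply,
      Prod.mk.injEq, smul_eq_mul]
    ring
  rw [f.as_sum]
  simp only [map_sum]
  rw [Finset.sum_comm, Finset.mul_sum]
  refine Finset.sum_congr rfl fun m hm => ?_
  -- A monomial of degree 2 is a multiset of two variables, so only products of two entries of
  -- `|φ⟩⟨φ|` need comparing.
  obtain ⟨p, q, rfl⟩ : ∃ p q : n × n, m = Finsupp.single p 1 + Finsupp.single q 1 := by
    have hdeg : m.degree = 2 := by
      by_contra h
      exact MvPolynomial.mem_support_iff.1 hm (hf.coeff_eq_zero h)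
    have hcard : (Finsupp.toMultiset m).card = 2 := by
      rw [Finsupp.card_toMultiset, ← hdeg, Finsupp.degree_apply]
      rfl
    obtain ⟨p, q, hpq⟩ := Multiset.card_eq_two.1 hcard
    refine ⟨p, q, ?_⟩
    rw [← Finsupp.toMultiset_toFinsupp m, hpq, Multiset.insert_eq_cons, ← Multiset.singleton_add,
      map_add, Multiset.toFinsupp_singleton, Multiset.toFinsupp_singleton]
  have e : (MvPolynomial.monomial (Finsupp.single p 1 + Finsupp.single q 1))
      (MvPolynomial.coeff (Finsupp.single p 1 + Finsupp.single q 1) f) =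
      MvPolynomial.coeff (Finsupp.single p 1 + Finsupp.single q 1) f •
        (MvPolynomial.X p * MvPolynomial.X q) := by
    simp [MvPolynomial.X, MvPolynomial.monomial_mul, MvPolynomial.smul_monomial]
  rw [e]
  simp only [map_smul, map_mul, MvPolynomial.aeval_X, MvPolynomial.smul_eval, MvPolynomial.eval_X,
    ← Finset.mul_sum]
  rw [← hent, smul_eq_mul]
  ring

end FourierDesign

/-! ### The common eigenbasis and its displaced design. -/

namespace FourierDesign

open Matrix

variable {d : ℕ} [Fact d.Prime]

lemma exists_isCommonEigenbasis (hd : d % 4 = 3) :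
    ∃ ψ : OrthonormalBasis (Fin d) ℂ (Ket d), IsCommonEigenbasis ψ := by
  classical
  have ho := odd_of_mod_four hd
  -- The `R_m` need not be self-adjoint; the sums over single circles are, and they span the same
  -- space.
  let T : ZMod d → Ket d →ₗ[ℂ] Ket d := fun n => toEuclideanLin (radial d (Pi.single n 1))
  have hT : ∀ n, (T n).IsSymmetric := fun n => by
    refine isSymmetric_toEuclideanLin_iff.2 ?_
    rw [IsHermitian, radial_conjTranspose ho]
    congr 1
    ext m
    by_cases h : m = n
    · subst h; simp
    · simp [h]
  have hC : Pairwise (Function.onFun Commute T) := by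
    intro n m _
    have h := radial_commute hd (Pi.single n 1) (Pi.single m 1)
    have e : ∀ A B : Matrix (ZMod d) (ZMod d) ℂ,
        toEuclideanLin (A * B) = toEuclideanLin A * toEuclideanLin B := by
      intro A B
      ext x : 1
      simp [Matrix.toLpLin_apply, Matrix.mulVec_mulVec]
    change T n * T m = T m * T n
    simp only [T, ← e, h.eq]
  have hint := LinearMap.IsSymmetric.directSum_isInternal_of_pairwise_commute hT hC
  have horth := LinearMap.IsSymmetric.orthogonalFamily_iInf_eigenspaces hT
  set V : (ZMod d → ℂ) → Submodule ℂ (Ket d) :=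
    fun γ => ⨅ j, Module.End.eigenspace (T j) (γ j) with hV
  -- The joint eigenvalues range over an infinite type; discarding the trivial eigenspaces leaves
  -- the finite index that a subordinate basis needs.
  have hfin : {γ | V γ ≠ ⊥}.Finite :=
    WellFoundedGT.finite_ne_bot_of_iSupIndep hint.submodule_iSupIndep
  have : Fintype {γ // V γ ≠ ⊥} := hfin.fintype
  have hint' : DirectSum.IsInternal fun γ : {γ // V γ ≠ ⊥} => V γ :=
    DirectSum.isInternal_ne_bot_iff.2 hint
  have horth' : OrthogonalFamily ℂ (fun γ : {γ // V γ ≠ ⊥} => V γ) fun γ => (V γ).subtypeₗᵢ :=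
    horth.comp Subtype.val_injective
  have hrank : Module.finrank ℂ (Ket d) = d := by simp
  let ψ := hint'.subordinateOrthonormalBasis hrank horth'
  refine ⟨ψ, fun m i => ?_⟩
  have hmem := hint'.subordinateOrthonormalBasis_subordinate hrank i horth'
  have hmem' : ∀ n, T n (ψ i) =
      (hint'.subordinateOrthonormalBasisIndex hrank i horth').1 n • ψ i :=
    fun n => Module.End.mem_eigenspace_iff.1 ((Submodule.mem_iInf _).1 hmem n)
  set γ := (hint'.subordinateOrthonormalBasisIndex hrank i horth').1
  let c : ZMod d → ℂ := fun n => tauChar ho (m * n) / d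
  refine ⟨∑ n, c n * γ n, Module.End.mem_eigenspace_iff.2 ?_, ψ.orthonormal.ne_zero i⟩
  rw [rMat_eq_radial ho]
  have hc : (fun n => tauChar ho (m * n) / (d : ℂ)) = ∑ n, c n • Pi.single n 1 := by
    ext k
    simp [c, Pi.single_apply]
  rw [hc]
  simp only [map_sum, map_smul, LinearMap.sum_apply, LinearMap.smul_apply]
  rw [Finset.sum_smul]
  refine Finset.sum_congr rfl fun n _ => ?_
  rw [← smul_smul, ← hmem' n]

section Eigenbasis

variable (ψ : OrthonormalBasis (Fin d) ℂ (Ket d))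

/-- The expectation values of the radial operators in the states of an orthonormal basis. -/
noncomputable def radialEigenvalue : (ZMod d → ℂ) →ₗ[ℂ] (Fin d → ℂ) where
  toFun c i := inner ℂ (ψ i) (toEuclideanLin (radial d c) (ψ i))
  map_add' c c' := by ext i; simp
  map_smul' z c := by ext i; simp

lemma radialEigenvalue_apply (c : ZMod d → ℂ) (i : Fin d) :
    radialEigenvalue ψ c i = inner ℂ (ψ i) (toEuclideanLin (radial d c) (ψ i)) := rfl

variable {ψ} (hd : d % 4 = 3) (hψ : IsCommonEigenbasis ψ)
include hd hψ

lemma radial_eigenvector (c : ZMod d → ℂ) (i : Fin d) :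
    toEuclideanLin (radial d c) (ψ i) = radialEigenvalue ψ c i • ψ i := by
  have : ∃ z : ℂ, toEuclideanLin (radial d c) (ψ i) = z • ψ i := by
    choose e he using fun m => hψ m i
    refine ⟨∑ m, (∑ n, c n * tauChar (odd_of_mod_four hd) (-(m * n))) * e m, ?_⟩
    rw [radial_eq_sum_rMat (odd_of_mod_four hd)]
    simp only [map_sum, map_smul, LinearMap.sum_apply, LinearMap.smul_apply]
    rw [Finset.sum_smul]
    refine Finset.sum_congr rfl fun m _ => ?_
    rw [(he m).apply_eq_smul, smul_smul]
  obtain ⟨z, hz⟩ := this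
  rw [radialEigenvalue_apply, hz, inner_smul_right, inner_self_eq_norm_sq_to_K, ψ.norm_eq_one]
  simp

lemma radialEigenvalue_injective : Function.Injective (radialEigenvalue ψ) := by
  rw [injective_iff_map_eq_zero]
  intro c hc
  have h : toEuclideanLin (radial d c) = 0 := by
    refine ψ.toBasis.ext fun i => ?_
    rw [ψ.coe_toBasis, radial_eigenvector hd hψ, hc]
    simp
  have h' : radial d c = 0 := by simpa using h
  exact radial_injective hd (by rw [h', map_zero])

/-- Both spaces have dimension `d`; hence every operator diagonal in `ψ` is radial. -/
lemma radialEigenvalue_surjective : Function.Surjective (radialEigenvalue ψ) :=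
  (LinearMap.injective_iff_surjective_of_finrank_eq_finrank (by simp)).1
    (radialEigenvalue_injective hd hψ)

lemma sum_radialEigenvalue_mul (c c' : ZMod d → ℂ) :
    ∑ i, radialEigenvalue ψ c i * radialEigenvalue ψ c' i =
      d * ∑ n, (circleCard d n : ℂ) * (c n * c' n) := by
  rw [← trace_radial_mul (odd_of_mod_four hd)]
  have : (radial d c * radial d c').trace =
      LinearMap.trace ℂ (Ket d) (toEuclideanLin (radial d c * radial d c')) := by
    change _ = LinearMap.trace ℂ _ (toLpLin 2 2 (radial d c * radial d c'))
    rw [toLpLin_eq_toLin, Matrix.trace_toLin_eq]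
  rw [this, LinearMap.trace_eq_sum_inner _ ψ]
  refine Finset.sum_congr rfl fun i _ => ?_
  have e : toEuclideanLin (radial d c * radial d c') (ψ i) =
      toEuclideanLin (radial d c) (toEuclideanLin (radial d c') (ψ i)) := by
    simp [Matrix.toLpLin_apply, Matrix.mulVec_mulVec]
  rw [e, radial_eigenvector hd hψ, map_smul, radial_eigenvector hd hψ, smul_smul,
    inner_smul_right, inner_self_eq_norm_sq_to_K, ψ.norm_eq_one]
  simp [mul_comm]

/-- The projections onto the vectors of a common eigenbasis are radial operators; their profiles
satisfy a quadratic identity. -/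
lemma exists_ketBra_eq_radial :
    ∃ p : Fin d → ZMod d → ℂ, (∀ i, ketBra (ψ i) = radial d (p i)) ∧
      ∀ n, ∑ i, p i n ^ 2 = 1 / (d * circleCard d n) := by
  choose p hp using fun i : Fin d => radialEigenvalue_surjective hd hψ (Pi.single i 1)
  refine ⟨p, fun i => ?_, fun n => ?_⟩
  · apply toEuclideanLin.injective
    refine ψ.toBasis.ext fun j => ?_
    rw [ψ.coe_toBasis, radial_eigenvector hd hψ, hp]
    have : toEuclideanLin (ketBra (ψ i)) (ψ j) = (inner ℂ (ψ i) (ψ j) : ℂ) • ψ i := by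
      ext a
      simp only [Matrix.toLpLin_apply, ketBra, Matrix.mulVec, dotProduct, PiLp.inner_apply,
        PiLp.smul_apply, Matrix.of_apply, smul_eq_mul, Finset.sum_mul, RCLike.inner_apply]
      exact Finset.sum_congr rfl fun b _ => by simp only [Complex.star_def]; ring
    rw [this, orthonormal_iff_ite.1 ψ.orthonormal]
    by_cases h : i = j
    · subst h; simp
    · simp [h, Ne.symm h]
  · have h0 : (d : ℂ) ≠ 0 := by exact_mod_cast (Fact.out : d.Prime).ne_zero
    have hN := circleCard_ne_zero hd n
    have hs : ∀ c : ZMod d → ℂ, ∑ m, (circleCard d m : ℂ) * (c m * (Pi.single n 1 : ZMod d → ℂ) m) =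
        circleCard d n * c n := by
      intro c
      rw [Finset.sum_eq_single n]
      · simp
      · intro m _ hm
        simp [hm]
      · simp
    -- Tracing the projection `i` against a circle sum gives its `i`-th eigenvalue; the squares of
    -- these are then summed by the trace form.
    have h1 : ∀ i, radialEigenvalue ψ (Pi.single n 1) i = d * (circleCard d n * p i n) := by
      intro i
      have := sum_radialEigenvalue_mul hd hψ (p i) (Pi.single n 1)
      rw [hp, hs, Finset.sum_eq_single i] at this
      · simpa using this
      · intro j _ hj
        simp [hj]
      · simp
    have h2 := sum_radialEigenvalue_mul hd hψ (Pi.single n 1) (Pi.single n 1)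
    rw [hs] at h2
    simp only [h1, Pi.single_eq_same, mul_one] at h2
    have h3 : ∑ i, d * (circleCard d n * p i n) * (d * (circleCard d n * p i n)) =
        (d * circleCard d n) ^ 2 * ∑ i, p i n ^ 2 := by
      rw [Finset.mul_sum]
      exact Finset.sum_congr rfl fun i _ => by ring
    rw [h3] at h2
    field_simp
    have h4 : (d : ℂ) * circleCard d n ≠ 0 := mul_ne_zero h0 hN
    apply mul_left_cancel₀ h4
    linear_combination h2

lemma isCommonEigenbasis_unique {ψ' : OrthonormalBasis (Fin d) ℂ (Ket d)}
    (hψ' : IsCommonEigenbasis ψ') :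
    ∃ σ : Equiv.Perm (Fin d), ∀ i, ∃ c : ℂ, ‖c‖ = 1 ∧ ψ' i = c • ψ (σ i) := by
  choose p hp using fun i : Fin d => radialEigenvalue_surjective hd hψ (Pi.single i 1)
  -- The projection onto `ψ i` is radial, so `ψ' j` is an eigenvector of it; a nonzero overlap
  -- forces eigenvalue `1`, and the other overlaps vanish.
  have key : ∀ i j, (inner ℂ (ψ i) (ψ' j) : ℂ) ≠ 0 → ∀ k, k ≠ i → (inner ℂ (ψ k) (ψ' j) : ℂ) = 0 := by
    intro i j hij k hk
    have hsum : ∀ l, (inner ℂ (ψ l) (toEuclideanLin (radial d (p i)) (ψ' j)) : ℂ) =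
        (Pi.single i 1 : Fin d → ℂ) l * inner ℂ (ψ l) (ψ' j) := by
      intro l
      conv_lhs => rw [← ψ.sum_repr' (ψ' j), map_sum]
      simp only [map_smul, radial_eigenvector hd hψ, hp, inner_sum, inner_smul_right,
        orthonormal_iff_ite.1 ψ.orthonormal]
      simp [mul_comm]
    have h1 := hsum i
    have h2 := hsum k
    rw [radial_eigenvector hd hψ', inner_smul_right] at h1 h2
    simp only [Pi.single_eq_same, one_mul, Pi.single_eq_of_ne hk, zero_mul] at h1 h2
    have h3 : radialEigenvalue ψ' (p i) j = 1 := mul_right_cancel₀ hij (by rw [h1, one_mul])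
    rw [h3, one_mul] at h2
    exact h2
  have hex : ∀ j, ∃ i, (inner ℂ (ψ i) (ψ' j) : ℂ) ≠ 0 := by
    intro j
    by_contra! h
    have := ψ.sum_repr' (ψ' j)
    simp only [h, zero_smul, Finset.sum_const_zero] at this
    have h1 := ψ'.norm_eq_one j
    rw [← this, norm_zero] at h1
    exact zero_ne_one h1
  choose s hs using hex
  have hexp : ∀ j, ψ' j = (inner ℂ (ψ (s j)) (ψ' j) : ℂ) • ψ (s j) := by
    intro j
    conv_lhs => rw [← ψ.sum_repr' (ψ' j)]
    rw [Finset.sum_eq_single (s j)]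
    · intro k _ hk
      rw [key _ j (hs j) k hk, zero_smul]
    · simp
  have hinj : Function.Injective s := by
    intro j k hjk
    by_contra hne
    have h0 : inner ℂ (ψ' j) (ψ' k) = 0 := ψ'.orthonormal.2 hne
    rw [hexp j, hexp k, hjk, inner_smul_left, inner_smul_right, inner_self_eq_norm_sq_to_K,
      ψ.norm_eq_one] at h0
    have hj := hs j
    rw [hjk] at hj
    simp only [one_pow, mul_one, map_one, mul_eq_zero, map_eq_zero] at h0
    exact h0.elim hj (hs k)
  refine ⟨Equiv.ofBijective s (Finite.injective_iff_bijective.1 hinj), fun j => ⟨_, ?_, hexp j⟩⟩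
  have := congrArg norm (hexp j)
  rw [norm_smul, ψ.norm_eq_one, ψ'.norm_eq_one, mul_one] at this
  exact this.symm

lemma sum_displacedProj_kronecker :
    (1 / (d : ℂ) ^ 3) • ∑ i : Fin d, ∑ a : ZMod d, ∑ b : ZMod d,
        displacedProj ψ i a b ⊗ₖ displacedProj ψ i a b =
      (2 / ((d : ℂ) * ((d : ℂ) + 1))) • symProj (ZMod d) := by
  have ho := odd_of_mod_four hd
  have h0 : (d : ℂ) ≠ 0 := by exact_mod_cast (Fact.out : d.Prime).ne_zero
  have h1 : (d : ℂ) + 1 ≠ 0 := by exact_mod_cast Nat.succ_ne_zero d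
  obtain ⟨p, hp, hsq⟩ := exists_ketBra_eq_radial hd hψ
  have hk : ∀ {ι κ : Type} [Fintype ι] [Fintype κ] (f : ι → Matrix (ZMod d) (ZMod d) ℂ)
      (g : κ → Matrix (ZMod d) (ZMod d) ℂ),
      (∑ i, f i) ⊗ₖ (∑ j, g j) = ∑ i, ∑ j, f i ⊗ₖ g j := by
    intro ι κ _ _ f g
    ext ⟨a, a'⟩ ⟨b, b'⟩
    simp [Matrix.sum_apply, Finset.sum_mul_sum]
  have hdisp : ∀ (i : Fin d) (w : ZMod d × ZMod d), displacedProj ψ i w.1 w.2 =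
      ∑ v : ZMod d × ZMod d, (p i (normSq v) * tauChar ho (2 * (w.2 * v.1 - w.1 * v.2))) •
        weyl d v.1 v.2 := by
    intro i w
    rw [displacedProj, hp, radial_apply, Finset.mul_sum, Finset.sum_mul]
    refine Finset.sum_congr rfl fun v _ => ?_
    rw [Matrix.mul_smul, Matrix.smul_mul, weyl_conj ho, smul_smul]
  have h2 := two_ne_zero_of_odd ho
  -- Orthogonality of the displacement characters leaves only the pairs `(v, -v)`.
  have hchar : ∀ v u : ZMod d × ZMod d, ∑ w : ZMod d × ZMod d,
      tauChar ho (2 * (w.2 * v.1 - w.1 * v.2)) * tauChar ho (2 * (w.2 * u.1 - w.1 * u.2)) =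
        if u = -v then (d : ℂ) ^ 2 else 0 := by
    intro v u
    have e : ∀ w : ZMod d × ZMod d,
        tauChar ho (2 * (w.2 * v.1 - w.1 * v.2)) * tauChar ho (2 * (w.2 * u.1 - w.1 * u.2)) =
        tauChar ho (w.1 * (-2 * (u.2 + v.2))) * tauChar ho (w.2 * (2 * (u.1 + v.1))) := by
      intro w
      rw [← AddChar.map_add_eq_mul, ← AddChar.map_add_eq_mul]
      congr 1
      ring
    simp only [e]
    rw [Fintype.sum_prod_type]
    simp only [← Finset.mul_sum, ← Finset.sum_mul, tauChar_mul_sum, mul_eq_zero, h2, neg_eq_zero,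
      false_or, Prod.ext_iff, Prod.fst_neg, Prod.snd_neg, ← eq_neg_iff_add_eq_zero]
    by_cases hx : u.1 = -v.1 <;> by_cases hy : u.2 = -v.2 <;> simp [hx, hy, sq]
  have hi : ∀ i : Fin d, ∑ a : ZMod d, ∑ b : ZMod d,
      displacedProj ψ i a b ⊗ₖ displacedProj ψ i a b =
        ∑ v : ZMod d × ZMod d, ((d : ℂ) ^ 2 * p i (normSq v) ^ 2) •
          (weyl d v.1 v.2 ⊗ₖ weyl d (-v.1) (-v.2)) := by
    intro i
    rw [← Fintype.sum_prod_type' (f := fun a b => displacedProj ψ i a b ⊗ₖ displacedProj ψ i a b)]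
    simp only [hdisp, hk, Matrix.smul_kronecker, Matrix.kronecker_smul, smul_smul]
    rw [Finset.sum_comm]
    refine Finset.sum_congr rfl fun v _ => ?_
    rw [Finset.sum_comm]
    have e : ∀ u w : ZMod d × ZMod d, p i (normSq u) * tauChar ho (2 * (w.2 * u.1 - w.1 * u.2)) *
        (p i (normSq v) * tauChar ho (2 * (w.2 * v.1 - w.1 * v.2))) =
        p i (normSq v) * p i (normSq u) * (tauChar ho (2 * (w.2 * v.1 - w.1 * v.2)) *
          tauChar ho (2 * (w.2 * u.1 - w.1 * u.2))) := fun u w => by ring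
    simp only [e, ← Finset.sum_smul, ← Finset.mul_sum, hchar]
    rw [Finset.sum_eq_single (-v)]
    · simp only [if_true, normSq_neg, Prod.fst_neg, Prod.snd_neg]
      congr 1
      ring
    · intro u _ hu
      simp [hu]
    · simp
  simp only [hi]
  rw [Finset.sum_comm]
  simp only [← Finset.sum_smul, ← Finset.mul_sum, hsq]
  -- The weight `d / N` is `d / (d + 1)` off the origin and `d` at it; the excess `d² / (d + 1)` at
  -- the origin supplies the identity term.
  have hcoef : ∀ v : ZMod d × ZMod d, (d : ℂ) ^ 2 * (1 / (d * circleCard d (normSq v))) =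
      d / (d + 1) + if v = 0 then (d : ℂ) ^ 2 / (d + 1) else 0 := by
    intro v
    by_cases hv : v = 0
    · subst hv
      rw [if_pos rfl, show normSq (0 : ZMod d × ZMod d) = 0 by simp [normSq], circleCard_zero hd]
      push_cast
      field_simp
      ring
    · rw [if_neg hv, circleCard_of_ne_zero hd (by rwa [Ne, normSq_eq_zero_iff hd])]
      push_cast
      field_simp
      ring
  simp only [hcoef, add_smul, Finset.sum_add_distrib, ite_smul, zero_smul, Finset.sum_ite_eq',
    Finset.mem_univ, if_true, ← Finset.smul_sum, sum_weyl_kronecker_weyl_neg ho]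
  simp only [Prod.fst_zero, Prod.snd_zero, neg_zero, weyl_zero, Matrix.one_kronecker_one,
    symProj_eq, smul_add, smul_smul]
  rw [add_comm]
  congr 2
  · field_simp
  · field_simp

lemma isEigenvector_fourierMat (i : Fin d) : IsEigenvector (fourierMat d) (ψ i) := by
  have ho := odd_of_mod_four hd
  have h0 : (d : ℂ) ≠ 0 := by exact_mod_cast (Fact.out : d.Prime).ne_zero
  have h2 := two_ne_zero_of_odd ho
  -- With `m = -1/2` the exponent completes to `2ab + m(s - (a + b))²`, so each entry is a Fourier
  -- phase times the Gauss sum `G`.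
  obtain ⟨m, hm⟩ : ∃ m : ZMod d, 2 * m = -1 := ⟨-1 / 2, by field_simp⟩
  let G : ℂ := ∑ s, tauChar ho (m * s ^ 2)
  have hR : rMat d m = (G / √(d : ℝ)) • fourierMat d := by
    ext a b
    have hsq : ((√(d : ℝ) : ℝ) : ℂ) * (√(d : ℝ) : ℝ) = d := by
      rw [← Complex.ofReal_mul, Real.mul_self_sqrt (Nat.cast_nonneg d), Complex.ofReal_natCast]
    have hF : omega d ^ (a.val * b.val) = tauChar ho (2 * a * b) := by
      rw [omega_eq_tau_sq, ← pow_mul, ← tauChar_natCast ho]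
      congr 1
      push_cast
      simp only [ZMod.natCast_val, ZMod.cast_id', id]
      ring
    rw [rMat_eq_radial ho, radial_apply, Matrix.sum_apply, Fintype.sum_prod_type,
      Finset.sum_eq_single (a - b)]
    · have e : ∀ s : ZMod d, tauChar ho (m * normSq (a - b, s)) / d *
          tauChar ho ((a - b) * s + 2 * s * b) =
          tauChar ho (2 * a * b) / d * tauChar ho (m * (s - (a + b)) ^ 2) := by
        intro s
        rw [div_mul_eq_mul_div, div_mul_eq_mul_div, ← AddChar.map_add_eq_mul,
          ← AddChar.map_add_eq_mul]
        congr 2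
        unfold normSq
        linear_combination (-2 * a * b + s * (a + b)) * hm
      have hG : ∑ s, tauChar ho (m * (s - (a + b)) ^ 2) = G :=
        Equiv.sum_comp (Equiv.subRight (a + b)) fun s => tauChar ho (m * s ^ 2)
      have hb : a = b + (a - b) := by ring
      simp only [Matrix.smul_apply, weyl_apply ho, if_pos hb, smul_eq_mul, e]
      rw [← Finset.mul_sum, hG, fourierMat, Matrix.of_apply, hF, ← hsq]
      push_cast
      field_simp
    · intro r _ hr
      refine Finset.sum_eq_zero fun s _ => ?_
      rw [Matrix.smul_apply, weyl_apply ho, if_neg, smul_zero]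
      contrapose! hr
      dsimp only at hr
      rw [hr]
      ring
    · simp
  -- The Gauss sum need not be evaluated: if it vanished, so would `R_m`, against injectivity of
  -- `radial`.
  have hne : G / √(d : ℝ) ≠ 0 := by
    intro h
    rw [h, zero_smul, rMat_eq_radial ho] at hR
    have := radial_injective hd (hR.trans (map_zero _).symm)
    have := congrFun this 0
    simp [h0] at this
  obtain ⟨c, hc⟩ := hψ m i
  refine ⟨(G / √(d : ℝ))⁻¹ * c, Module.End.mem_eigenspace_iff.2 ?_, hc.2⟩
  have := hc.apply_eq_smul
  rw [hR, map_smul, LinearMap.smul_apply] at this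
  rw [← smul_smul, ← this, smul_smul, inv_mul_cancel₀ hne, one_smul]

lemma isProjectiveTwoDesign_displacedKet : IsProjectiveTwoDesign (displacedKet ψ) := by
  have ho := odd_of_mod_four hd
  have hket : ∀ x : Fin d × ZMod d × ZMod d,
      ketBra (displacedKet ψ x) = displacedProj ψ x.1 x.2.1 x.2.2 := by
    intro x
    have h : ∀ (W : Matrix (ZMod d) (ZMod d) ℂ) (v : Ket d),
        ketBra (toEuclideanLin W v) = W * ketBra v * Wᴴ := by
      intro W v
      have e : ∀ v : Ket d, ketBra v = Matrix.vecMulVec v.ofLp (star v.ofLp) := fun v => rfl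
      rw [e, e, Matrix.mul_vecMulVec, Matrix.vecMulVec_mul, ← Matrix.star_mulVec]
      rfl
    rw [displacedKet, h, displacedProj, weyl_conjTranspose ho x.2, weyl_inv ho x.2]
  refine isProjectiveTwoDesign_of_sum_kronecker _ (fun x => ?_) ?_
  · have hW : (weyl d x.2.1 x.2.2)ᴴ * weyl d x.2.1 x.2.2 = 1 := by
      rw [weyl_conjTranspose ho x.2]
      exact mul_eq_one_comm.1 (weyl_mul_neg ho x.2)
    have h : inner ℂ (displacedKet ψ x) (displacedKet ψ x) = inner ℂ (ψ x.1) (ψ x.1) := by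
      rw [displacedKet, ← LinearMap.adjoint_inner_right, ← toEuclideanLin_conjTranspose_eq_adjoint]
      congr 1
      simp [Matrix.toLpLin_apply, Matrix.mulVec_mulVec, hW]
    have h' := inner_self_eq_norm_sq (𝕜 := ℂ) (displacedKet ψ x)
    rw [h, inner_self_eq_norm_sq, ψ.norm_eq_one, one_pow] at h'
    exact (pow_eq_one_iff_of_nonneg (norm_nonneg _) two_ne_zero).1 h'.symm
  · simp only [hket]
    have := sum_displacedProj_kronecker hd hψ
    rw [Fintype.sum_prod_type]
    simp only [Fintype.sum_prod_type, Fintype.card_prod, Fintype.card_fin, ZMod.card]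
    rw [← this]
    congr 1
    push_cast
    ring

end Eigenbasis

end FourierDesign

theorem theorem1 (d k : ℕ) [Fact d.Prime] (hd : d = 4 * k + 3) :
    (∃ ψ : OrthonormalBasis (Fin d) ℂ (Ket d), IsCommonEigenbasis ψ) ∧
    (∀ ψ ψ' : OrthonormalBasis (Fin d) ℂ (Ket d),
      IsCommonEigenbasis ψ → IsCommonEigenbasis ψ' →
        ∃ σ : Equiv.Perm (Fin d), ∀ i, ∃ c : ℂ, ‖c‖ = 1 ∧ ψ' i = c • ψ (σ i)) ∧
    ∀ ψ : OrthonormalBasis (Fin d) ℂ (Ket d), IsCommonEigenbasis ψ →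
      (∀ i, IsEigenvector (fourierMat d) (ψ i)) ∧
      IsProjectiveTwoDesign (displacedKet ψ) ∧
      (1 / (d : ℂ) ^ 3) • ∑ i : Fin d, ∑ a : ZMod d, ∑ b : ZMod d,
          displacedProj ψ i a b ⊗ₖ displacedProj ψ i a b =
        (2 / ((d : ℂ) * ((d : ℂ) + 1))) • symProj (ZMod d) := by
  have h : d % 4 = 3 := by omega
  exact ⟨exists_isCommonEigenbasis h, fun _ _ hψ hψ' => isCommonEigenbasis_unique h hψ hψ',
    fun _ hψ => ⟨isEigenvector_fourierMat h hψ, isProjectiveTwoDesign_displacedKet h hψ,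
      sum_displacedProj_kronecker h hψ⟩⟩
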